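/- **Theorem (Kiefer–Wolfowitz).** Let $X_1, X_2, \dots$ be i.i.d. random variables with a nonincreasing density $f$ on $(0,\infty)$ and distribution function $F$ (so $F$ is concave on $[0,\infty)$ and $F(0)=0$). Let $\alpha_1(F) = \inf\{t : F(t) = 1\}$ and write $\|g\| = \sup_{0\le t\le \alpha_1(F)} |g(t)|$. Let $\mathbb{F}_n(t) = n^{-1}\#\{i\le n : X_i\le t\}$ be the empirical distribution function, and let $\widehat F_n$ be the least concave majorant of $\mathbb{F}_n$ on $[0,\infty)$ (the Grenander maximum likelihood estimator of $F$). Suppose that $\alpha_1(F) < \infty$, that $f$ is differentiable on $(0,\alpha_1(F))$, that $f'$ is continuous on $[0,\alpha_1(F)]$ (i.e. $f'$ on $(0,\alpha_1(F))$ extends continuously to the closed interval), and that $$\beta_1(F) = \inf_{0<t<\alpha_1(F)} \frac{-f'(t)}{f(t)^2} > 0, \qquad \gamma_1(F) = \frac{\sup_{0<t<\alpha_1(F)} (-f'(t))}{\inf_{0<t<\alpha_1(F)} f(t)^2} < \infty .$$ Then $$\|\widehat F_n - \mathbb{F}_n\| = O\big((n^{-1}\log n)^{2/3}\big) \quad \text{almost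 surely};$$ that is, there is a non-random constant $C<\infty$ such that, almost surely, $\|\widehat F_n - \mathbb{F}_n\| \le C (n^{-1}\log n)^{2/3}$ for all sufficiently large $n$. -/

import Mathlib

open MeasureTheory ProbabilityTheory Set Filter Topology

noncomputable section

namespace KieferWolfowitz

/-- The empirical distribution function of the first `n` terms of the sample `x`:
`t ↦ n⁻¹ #{i < n : x i ≤ t}`. -/
def empiricalCDF (x : ℕ → ℝ) (n : ℕ) (t : ℝ) : ℝ :=
  (n : ℝ)⁻¹ * ∑ i ∈ Finset.range n, (Set.Iic t).indicator (fun _ => (1 : ℝ)) (x i)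

/-- The least concave majorant of `g` on `[0, ∞)`, as the pointwise infimum of all functions that
are concave on `[0, ∞)` and lie above `g` there. It is meaningful at points `t ≥ 0`, for functions
`g` that have a concave majorant on `[0, ∞)`, e.g. bounded ones. -/
def leastConcaveMajorant (g : ℝ → ℝ) (t : ℝ) : ℝ :=
  sInf {y : ℝ | ∃ h : ℝ → ℝ, ConcaveOn ℝ (Set.Ici 0) h ∧ (∀ s ∈ Set.Ici (0 : ℝ), g s ≤ h s) ∧
    y = h t}

/-- The Grenander estimator of the distribution function: the least concave majorant of the
empirical distribution function. -/
def grenanderCDF (x : ℕ → ℝ) (n : ℕ) : ℝ → ℝ :=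
  leastConcaveMajorant (empiricalCDF x n)

/-- `α₁(F) = inf {t : F t = 1}`. The condition `α₁(F) < ∞` says that this set is nonempty. -/
def alphaOne (F : ℝ → ℝ) : ℝ :=
  sInf {t : ℝ | F t = 1}

/-- `β₁ = inf_{0 < t < a} (-f'(t) / f(t)²)`, where `f'` is given as a separate function.
The infimum of a family that is not bounded below is `0` here, so that `0 < betaOne f f' a` says
that the infimum is a genuine one and is positive. -/
def betaOne (f f' : ℝ → ℝ) (a : ℝ) : ℝ :=
  ⨅ t : Set.Ioo (0 : ℝ) a, -f' t / f t ^ 2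

/-- `γ₁ = sup_{0 < t < a} (-f'(t)) / inf_{0 < t < a} f(t)²`, as an extended nonnegative number
(it is used for `f' ≤ 0`); in particular it is `∞` if the supremum is positive and the infimum
is `0`, or if the supremum is `∞`. -/
def gammaOne (f f' : ℝ → ℝ) (a : ℝ) : ENNReal :=
  (⨆ t : Set.Ioo (0 : ℝ) a, ENNReal.ofReal (-f' t)) /
    (⨅ t : Set.Ioo (0 : ℝ) a, ENNReal.ofReal (f t ^ 2))

/-- The supremum norm on `[0, a]`. -/
def supNorm (a : ℝ) (g : ℝ → ℝ) : ℝ :=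
  ⨆ t : Set.Icc (0 : ℝ) a, |g t|

end KieferWolfowitz

end

namespace KieferWolfowitz

/-! ### The distribution function -/

section Analytic

variable {μ : Measure ℝ} [IsProbabilityMeasure μ] {f f' : ℝ → ℝ}

/-! The conditions on `β₁` and `γ₁` give `-f' ≥ b > 0`, so `F` is strongly concave: at every `c` in
`[0, α₁]` it lies below a parabola through `(c, F c)` with curvature `-b` and slope `g ≥ 0` at `c`
(`exists_supporting_parabola`). Put `h = (log n / n)^(1/3)`. Chernoff bounds on a grid of mesh `α₁ /
n` and Borel–Cantelli show that empirical increments over length `d` differ from those of `F` by at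
most `D h d + B h²` (`ae_eventually_abs_increment_sub_le`).

The parabola absorbs the linear error, since `D h d - b d² / 2 ≤ D² h² / (2b)`. Hence the line of
slope `g` through `c`, raised by a constant times `h²` above the empirical value, majorizes the
empirical function. Being concave, it bounds the least concave majorant at `c`
(`abs_leastConcaveMajorant_sub_le`). The constants do not depend on `c`. -/

theorem cdf_eq_zero_of_nonpos
    (hμ : μ = (volume.restrict (Ioi (0 : ℝ))).withDensity (fun t => ENNReal.ofReal (f t)))
    {t : ℝ} (ht : t ≤ 0) : cdf μ t = 0 := by
  rw [cdf_eq_real, measureReal_eq_zero_iff, hμ, withDensity_apply _ measurableSet_Iic,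
    Measure.restrict_restrict measurableSet_Iic]
  have : Iic t ∩ Ioi (0 : ℝ) = ∅ := by
    ext x
    simp only [mem_inter_iff, mem_Iic, mem_Ioi, mem_empty_iff_false, iff_false, not_and, not_lt]
    exact fun h => h.trans ht
  simp [this]

theorem alphaOne_nonneg
    (hμ : μ = (volume.restrict (Ioi (0 : ℝ))).withDensity (fun t => ENNReal.ofReal (f t))) :
    0 ≤ alphaOne (cdf μ) := by
  refine Real.sInf_nonneg fun t ht => ?_
  by_contra h
  have h0 := cdf_eq_zero_of_nonpos hμ (not_le.1 h).le
  have h1 : cdf μ t = 1 := ht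
  linarith

/-- Right continuity makes the infimum attained. -/
theorem cdf_alphaOne {μ : Measure ℝ} (hα : {t : ℝ | cdf μ t = 1}.Nonempty) :
    cdf μ (alphaOne (cdf μ)) = 1 := by
  have hgt : ∀ t ∈ Ioi (alphaOne (cdf μ)), cdf μ t = 1 := by
    intro t ht
    obtain ⟨s, hs, hst⟩ := exists_lt_of_csInf_lt hα ht
    refine le_antisymm (cdf_le_one μ t) ?_
    have h1 : cdf μ s = 1 := hs
    exact h1 ▸ monotone_cdf μ hst.le
  have hright : Tendsto (cdf μ) (𝓝[>] (alphaOne (cdf μ))) (𝓝 (cdf μ (alphaOne (cdf μ)))) :=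
    ((cdf μ).right_continuous _).tendsto.mono_left (nhdsWithin_mono _ Ioi_subset_Ici_self)
  refine tendsto_nhds_unique hright ?_
  refine tendsto_const_nhds.congr' ?_
  filter_upwards [self_mem_nhdsWithin] with t ht using (hgt t ht).symm

theorem alphaOne_pos
    (hμ : μ = (volume.restrict (Ioi (0 : ℝ))).withDensity (fun t => ENNReal.ofReal (f t)))
    (hα : {t : ℝ | cdf μ t = 1}.Nonempty) : 0 < alphaOne (cdf μ) := by
  rcases (alphaOne_nonneg hμ).lt_or_eq with h | h
  · exact h
  · have h1 := cdf_alphaOne hα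
    rw [cdf_eq_zero_of_nonpos hμ h.ge] at h1
    norm_num at h1

theorem integrableOn_density (hf_nonneg : ∀ t ∈ Ioi (0 : ℝ), 0 ≤ f t)
    (hf_anti : AntitoneOn f (Ioi 0))
    (hμ : μ = (volume.restrict (Ioi (0 : ℝ))).withDensity (fun t => ENNReal.ofReal (f t))) :
    IntegrableOn f (Ioi 0) := by
  refine ⟨(aemeasurable_restrict_of_antitoneOn measurableSet_Ioi hf_anti).aestronglyMeasurable,
    ?_⟩
  rw [hasFiniteIntegral_iff_ofReal
    ((ae_restrict_iff' measurableSet_Ioi).2 (ae_of_all _ hf_nonneg))]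
  have h1 : μ univ = 1 := measure_univ
  rw [hμ, withDensity_apply _ MeasurableSet.univ, Measure.restrict_univ] at h1
  rw [h1]
  exact ENNReal.one_lt_top

theorem cdf_sub_cdf_eq_integral (hf_nonneg : ∀ t ∈ Ioi (0 : ℝ), 0 ≤ f t)
    (hf_anti : AntitoneOn f (Ioi 0))
    (hμ : μ = (volume.restrict (Ioi (0 : ℝ))).withDensity (fun t => ENNReal.ofReal (f t)))
    {s t : ℝ} (hs : 0 ≤ s) (hst : s ≤ t) :
    cdf μ t - cdf μ s = ∫ u in s..t, f u := by
  have hsub : Ioc s t ⊆ Ioi 0 := fun u hu => hs.trans_lt hu.1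
  have hint := (integrableOn_density hf_nonneg hf_anti hμ).mono_set hsub
  have hnn : 0 ≤ᵐ[volume.restrict (Ioc s t)] f :=
    (ae_restrict_iff' measurableSet_Ioc).2 (ae_of_all _ fun u hu => hf_nonneg u (hsub hu))
  have h1 : μ (Ioc s t) = ENNReal.ofReal (cdf μ t - cdf μ s) := by
    conv_lhs => rw [← measure_cdf μ]
    exact StieltjesFunction.measure_Ioc _ _ _
  have h2 : μ (Ioc s t) = ENNReal.ofReal (∫ u in s..t, f u) := by
    conv_lhs => rw [hμ]
    rw [withDensity_apply _ measurableSet_Ioc, Measure.restrict_restrict measurableSet_Ioc,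
      inter_eq_self_of_subset_left hsub, intervalIntegral.integral_of_le hst,
      ofReal_integral_eq_lintegral_ofReal hint hnn]
  rw [h1] at h2
  refine (ENNReal.ofReal_eq_ofReal_iff (sub_nonneg.2 (monotone_cdf μ hst)) ?_).1 h2
  rw [intervalIntegral.integral_of_le hst]
  exact integral_nonneg_of_ae hnn

theorem cdf_sub_cdf_le (hf_nonneg : ∀ t ∈ Ioi (0 : ℝ), 0 ≤ f t)
    (hf_anti : AntitoneOn f (Ioi 0))
    (hμ : μ = (volume.restrict (Ioi (0 : ℝ))).withDensity (fun t => ENNReal.ofReal (f t)))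
    {s t : ℝ} (hs : 0 ≤ s) (hst : s ≤ t) {q : ℝ → ℝ} (hq : Continuous q)
    (hfq : ∀ u ∈ Ioo s t, f u ≤ q u) :
    cdf μ t - cdf μ s ≤ ∫ u in s..t, q u := by
  rw [cdf_sub_cdf_eq_integral hf_nonneg hf_anti hμ hs hst]
  refine intervalIntegral.integral_mono_on_of_le_Ioo hst ?_ (hq.intervalIntegrable _ _) hfq
  exact (intervalIntegrable_iff_integrableOn_Ioc_of_le hst).2
    ((integrableOn_density hf_nonneg hf_anti hμ).mono_set fun u hu => hs.trans_lt hu.1)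

theorem le_cdf_sub_cdf (hf_nonneg : ∀ t ∈ Ioi (0 : ℝ), 0 ≤ f t)
    (hf_anti : AntitoneOn f (Ioi 0))
    (hμ : μ = (volume.restrict (Ioi (0 : ℝ))).withDensity (fun t => ENNReal.ofReal (f t)))
    {s t : ℝ} (hs : 0 ≤ s) (hst : s ≤ t) {q : ℝ → ℝ} (hq : Continuous q)
    (hfq : ∀ u ∈ Ioo s t, q u ≤ f u) :
    ∫ u in s..t, q u ≤ cdf μ t - cdf μ s := by
  rw [cdf_sub_cdf_eq_integral hf_nonneg hf_anti hμ hs hst]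
  refine intervalIntegral.integral_mono_on_of_le_Ioo hst (hq.intervalIntegrable _ _) ?_ hfq
  exact (intervalIntegrable_iff_integrableOn_Ioc_of_le hst).2
    ((integrableOn_density hf_nonneg hf_anti hμ).mono_set fun u hu => hs.trans_lt hu.1)

theorem integral_affine (g b c s t : ℝ) :
    ∫ u in s..t, (g - b * (u - c)) = g * (t - s) - b / 2 * ((t - c) ^ 2 - (s - c) ^ 2) := by
  have hderiv : ∀ u ∈ uIcc s t,
      HasDerivAt (fun u => g * u - b / 2 * (u - c) ^ 2) (g - b * (u - c)) u := by
    intro u _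
    have h := ((hasDerivAt_id' u).const_mul g).fun_sub
      ((((hasDerivAt_id' u).sub_const c).fun_pow 2).const_mul (b / 2))
    refine h.congr_deriv ?_
    norm_num
    ring
  rw [intervalIntegral.integral_eq_sub_of_hasDerivAt hderiv
    (Continuous.intervalIntegrable (by fun_prop) _ _)]
  ring

/-! ### Consequences of the conditions on `β₁` and `γ₁` -/

theorem betaOne_mul_sq_le {a : ℝ} (hβ : 0 < betaOne f f' a) {t : ℝ} (ht : t ∈ Ioo 0 a) :
    f t ≠ 0 ∧ betaOne f f' a * f t ^ 2 ≤ -f' t := by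
  have hbdd : BddBelow (range fun t : Ioo (0 : ℝ) a => -f' t / f t ^ 2) := by
    by_contra h
    rw [betaOne, Real.iInf_of_not_bddBelow h] at hβ
    exact lt_irrefl _ hβ
  have hle : betaOne f f' a ≤ -f' t / f t ^ 2 := ciInf_le hbdd (⟨t, ht⟩ : Ioo (0 : ℝ) a)
  have hne : f t ≠ 0 := by
    intro h
    rw [h] at hle
    norm_num at hle
    linarith
  exact ⟨hne, (le_div_iff₀ (by positivity)).1 hle⟩

/-- The bound is `b = β₁ · inf f²`. Finiteness of `γ₁` serves only to exclude `inf f² = 0`: its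
numerator is nonzero, so a zero denominator would give `⊤`. -/
theorem exists_pos_le_neg_deriv {a : ℝ} (ha : 0 < a) (hβ : 0 < betaOne f f' a)
    (hγ : gammaOne f f' a < ⊤) : ∃ b > 0, ∀ t ∈ Ioo 0 a, b ≤ -f' t := by
  have hmid : a / 2 ∈ Ioo 0 a := ⟨by linarith, by linarith⟩
  have hnum : (⨆ t : Ioo (0 : ℝ) a, ENNReal.ofReal (-f' t)) ≠ 0 := by
    have h := betaOne_mul_sq_le hβ hmid
    have hpos : 0 < -f' (a / 2) :=
      lt_of_lt_of_le (mul_pos hβ (pow_two_pos_of_ne_zero h.1)) h.2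
    have hle : ENNReal.ofReal (-f' (a / 2)) ≤ ⨆ t : Ioo (0 : ℝ) a, ENNReal.ofReal (-f' t) :=
      le_iSup (fun t : Ioo (0 : ℝ) a => ENNReal.ofReal (-f' t)) ⟨a / 2, hmid⟩
    exact ((ENNReal.ofReal_pos.2 hpos).trans_le hle).ne'
  have hle (t : ℝ) (ht : t ∈ Ioo 0 a) :
      (⨅ t : Ioo (0 : ℝ) a, ENNReal.ofReal (f t ^ 2)) ≤ ENNReal.ofReal (f t ^ 2) :=
    iInf_le (fun t : Ioo (0 : ℝ) a => ENNReal.ofReal (f t ^ 2)) ⟨t, ht⟩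
  have hden : (⨅ t : Ioo (0 : ℝ) a, ENNReal.ofReal (f t ^ 2)) ≠ 0 := by
    intro h
    rw [gammaOne, h, ENNReal.div_zero hnum] at hγ
    exact lt_irrefl _ hγ
  refine ⟨betaOne f f' a * (⨅ t : Ioo (0 : ℝ) a, ENNReal.ofReal (f t ^ 2)).toReal,
    mul_pos hβ (ENNReal.toReal_pos hden (ne_top_of_le_ne_top ENNReal.ofReal_ne_top
      (hle _ hmid))), fun t ht => ?_⟩
  refine le_trans ?_ (betaOne_mul_sq_le hβ ht).2
  gcongr
  exact ENNReal.toReal_le_of_le_ofReal (sq_nonneg _) (hle t ht)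

theorem antitoneOn_add_mul {a b : ℝ} (hf' : ∀ t ∈ Ioo 0 a, HasDerivAt f (f' t) t)
    (hb : ∀ t ∈ Ioo 0 a, b ≤ -f' t) : AntitoneOn (fun t => f t + b * t) (Ioo 0 a) := by
  have hd : ∀ t ∈ Ioo 0 a, HasDerivAt (fun t => f t + b * t) (f' t + b) t := by
    intro t ht
    simpa using (hf' t ht).fun_add ((hasDerivAt_id' t).const_mul b)
  refine antitoneOn_of_deriv_nonpos (convex_Ioo 0 a)
    (fun t ht => (hd t ht).continuousAt.continuousWithinAt) ?_ ?_
  · rw [interior_Ioo]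
    exact fun t ht => (hd t ht).differentiableAt.differentiableWithinAt
  · rw [interior_Ioo]
    intro t ht
    rw [(hd t ht).deriv]
    linarith [hb t ht]

theorem exists_density_bound {a : ℝ} (ha : 0 < a) (hf_anti : AntitoneOn f (Ioi 0))
    (hf' : ∀ t ∈ Ioo 0 a, HasDerivAt f (f' t) t) (hf'_cont : ContinuousOn f' (Icc 0 a)) :
    ∃ D, 0 ≤ D ∧ ∀ t ∈ Ioi 0, f t ≤ D := by
  obtain ⟨M, hM⟩ := isCompact_Icc.exists_bound_of_continuousOn hf'_cont
  have hmid : a / 2 ∈ Ioo 0 a := ⟨by linarith, by linarith⟩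
  -- With `|f'| ≤ M`, the function `f t + M t` is nondecreasing, which bounds `f` near `0`; past `a
  -- / 2` monotonicity of `f` suffices.
  have hanti := antitoneOn_add_mul (f := fun t => -f t) (f' := fun t => -f' t) (b := -M)
    (fun t ht => (hf' t ht).neg) (fun t ht => by
      have h := (abs_le.1 (hM t (Ioo_subset_Icc_self ht))).1
      simpa using h)
  have hM0 : 0 ≤ M := (norm_nonneg _).trans (hM _ (Ioo_subset_Icc_self hmid))
  refine ⟨|f (a / 2)| + M * (a / 2), by positivity, fun t ht => ?_⟩
  have h0 := le_abs_self (f (a / 2))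
  have h1 : 0 ≤ M * (a / 2) := by positivity
  rcases le_total t (a / 2) with h | h
  · have h2 := hanti (show t ∈ Ioo 0 a from ⟨ht, by linarith⟩) hmid h
    have h3 : 0 ≤ M * t := mul_nonneg hM0 (le_of_lt ht)
    dsimp only at h2
    linarith
  · have h2 := hf_anti (show a / 2 ∈ Ioi 0 from hmid.1) ht h
    linarith

/-- At each point the graph of the density is separated by a line of slope `-b`. -/
theorem exists_separating_slope {a b D : ℝ} (ha : 0 < a) (hb : 0 ≤ b) (hD : 0 ≤ D)
    (hf_nonneg : ∀ t ∈ Ioi (0 : ℝ), 0 ≤ f t) (hfD : ∀ t ∈ Ioi 0, f t ≤ D)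
    (hanti : AntitoneOn (fun t => f t + b * t) (Ioo 0 a)) {c : ℝ} (hc : c ∈ Icc 0 a) :
    ∃ g, 0 ≤ g ∧ (∀ u ∈ Ioo c a, f u ≤ g - b * (u - c)) ∧
      ∀ u ∈ Ioo 0 c, g - b * (u - c) ≤ f u := by
  rcases hc.1.eq_or_lt with rfl | hc0
  -- At `c = 0` nothing lies to the left, so any sufficiently large slope works.
  · refine ⟨D + b * a, by positivity, fun u hu => ?_, fun u hu => ?_⟩
    · have h1 := hfD u hu.1
      have h2 := mul_le_mul_of_nonneg_left hu.2.le hb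
      linarith
    · exact absurd (hu.1.trans hu.2) (lt_irrefl _)
  · set φ : ℝ → ℝ := fun t => f t + b * t with hφ
    have hsub : Ioo 0 c ⊆ Ioo 0 a := Ioo_subset_Ioo_right hc.2
    have hne : (φ '' Ioo 0 c).Nonempty := (nonempty_Ioo.2 hc0).image φ
    have hlow : ∀ y ∈ φ '' Ioo 0 c, b * c ≤ y := by
      rintro _ ⟨u, hu, rfl⟩
      have key : ∀ v ∈ Ioo u c, b * v ≤ φ u := by
        intro v hv
        have hv0 : v ∈ Ioo 0 c := ⟨hu.1.trans hv.1, hv.2⟩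
        have h1 : φ v ≤ φ u := hanti (hsub hu) (hsub hv0) hv.1.le
        have h2 := hf_nonneg v hv0.1
        have h3 : φ v = f v + b * v := rfl
        linarith
      have hcl : c ∈ closure (Ioo u c) := by
        rw [closure_Ioo hu.2.ne]
        exact right_mem_Icc.2 hu.2.le
      exact (closure_minimal (t := {v | b * v ≤ φ u}) key
        (isClosed_le (by fun_prop) continuous_const)) hcl
    -- As `φ` is nonincreasing, this infimum is its left limit at `c`, so `g` is the left limit of
    -- `f`. This treats `c < a` and `c = a` alike.
    refine ⟨sInf (φ '' Ioo 0 c) - b * c, sub_nonneg.2 (le_csInf hne hlow), fun u hu => ?_,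
      fun u hu => ?_⟩
    · have h1 : φ u ≤ sInf (φ '' Ioo 0 c) := by
        refine le_csInf hne ?_
        rintro _ ⟨v, hv, rfl⟩
        exact hanti (hsub hv) ⟨hc0.trans hu.1, hu.2⟩ (hv.2.trans hu.1).le
      have h3 : φ u = f u + b * u := rfl
      linarith
    · have h1 : sInf (φ '' Ioo 0 c) ≤ φ u := csInf_le ⟨_, hlow⟩ ⟨u, hu, rfl⟩
      have h3 : φ u = f u + b * u := rfl
      linarith

/-- The distribution function lies below a parabola touching it at a given point. -/
theorem exists_supporting_parabola {a b D : ℝ} (ha : 0 < a) (hb : 0 ≤ b) (hD : 0 ≤ D)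
    (hf_nonneg : ∀ t ∈ Ioi (0 : ℝ), 0 ≤ f t) (hf_anti : AntitoneOn f (Ioi 0))
    (hμ : μ = (volume.restrict (Ioi (0 : ℝ))).withDensity (fun t => ENNReal.ofReal (f t)))
    (hfD : ∀ t ∈ Ioi 0, f t ≤ D)
    (hanti : AntitoneOn (fun t => f t + b * t) (Ioo 0 a)) {c : ℝ} (hc : c ∈ Icc 0 a) :
    ∃ g, 0 ≤ g ∧ ∀ t ∈ Icc 0 a, cdf μ t ≤ cdf μ c + g * (t - c) - b / 2 * (t - c) ^ 2 := by
  obtain ⟨g, hg, hright, hleft⟩ := exists_separating_slope ha hb hD hf_nonneg hfD hanti hc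
  refine ⟨g, hg, fun t ht => ?_⟩
  have hq : Continuous fun u => g - b * (u - c) := by fun_prop
  rcases le_total c t with h | h
  · have h1 := cdf_sub_cdf_le hf_nonneg hf_anti hμ hc.1 h hq
      (fun u hu => hright u ⟨hu.1, hu.2.trans_le ht.2⟩)
    rw [integral_affine] at h1
    nlinarith
  · have h1 := le_cdf_sub_cdf hf_nonneg hf_anti hμ ht.1 h hq
      (fun u hu => hleft u ⟨ht.1.trans_lt hu.1, hu.2⟩)
    rw [integral_affine] at h1
    nlinarith

theorem cdf_sub_cdf_le_mul {D : ℝ} (hf_nonneg : ∀ t ∈ Ioi (0 : ℝ), 0 ≤ f t)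
    (hf_anti : AntitoneOn f (Ioi 0))
    (hμ : μ = (volume.restrict (Ioi (0 : ℝ))).withDensity (fun t => ENNReal.ofReal (f t)))
    (hfD : ∀ t ∈ Ioi 0, f t ≤ D) {s t : ℝ} (hs : 0 ≤ s) (hst : s ≤ t) :
    cdf μ t - cdf μ s ≤ D * (t - s) := by
  have h := cdf_sub_cdf_le hf_nonneg hf_anti hμ hs hst (q := fun _ => D) continuous_const
    (fun u hu => hfD u (hs.trans_lt hu.1))
  rw [intervalIntegral.integral_const, smul_eq_mul, mul_comm] at h
  exact h

end Analytic

/-! ### The least concave majorant of the empirical distribution function -/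

theorem empiricalCDF_mono (x : ℕ → ℝ) (n : ℕ) : Monotone (empiricalCDF x n) := by
  intro s t hst
  refine mul_le_mul_of_nonneg_left (Finset.sum_le_sum fun i _ => ?_) (by positivity)
  exact indicator_le_indicator_of_subset (Iic_subset_Iic.2 hst) (fun _ => zero_le_one) _

theorem empiricalCDF_sub (x : ℕ → ℝ) (n : ℕ) {s t : ℝ} (hst : s ≤ t) :
    empiricalCDF x n t - empiricalCDF x n s =
      (n : ℝ)⁻¹ * ∑ i ∈ Finset.range n, (Ioc s t).indicator (fun _ => (1 : ℝ)) (x i) := by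
  rw [empiricalCDF, empiricalCDF, ← mul_sub, ← Finset.sum_sub_distrib]
  congr 1
  refine Finset.sum_congr rfl fun i _ => ?_
  simp only [indicator_apply, mem_Iic, mem_Ioc]
  grind

theorem empiricalCDF_eq_of_forall_le {x : ℕ → ℝ} {a : ℝ} (hx : ∀ i, x i ≤ a) (n : ℕ) {t : ℝ}
    (ht : a ≤ t) : empiricalCDF x n t = empiricalCDF x n a := by
  rw [empiricalCDF, empiricalCDF]
  congr 1
  refine Finset.sum_congr rfl fun i _ => ?_
  rw [indicator_of_mem (show x i ∈ Iic t from (hx i).trans ht),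
    indicator_of_mem (show x i ∈ Iic a from hx i)]

/-- One concave majorant must be supplied: otherwise the `sInf` would be that of the empty set. -/
theorem le_leastConcaveMajorant {G h : ℝ → ℝ} (hh : ConcaveOn ℝ (Ici 0) h)
    (hGh : ∀ s ∈ Ici (0 : ℝ), G s ≤ h s) {t : ℝ} (ht : 0 ≤ t) :
    G t ≤ leastConcaveMajorant G t := by
  refine le_csInf ⟨_, h, hh, hGh, rfl⟩ ?_
  rintro _ ⟨k, -, hk, rfl⟩
  exact hk t ht

theorem leastConcaveMajorant_le {G h : ℝ → ℝ} (hh : ConcaveOn ℝ (Ici 0) h)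
    (hGh : ∀ s ∈ Ici (0 : ℝ), G s ≤ h s) {t : ℝ} (ht : 0 ≤ t) :
    leastConcaveMajorant G t ≤ h t := by
  refine csInf_le ⟨G t, ?_⟩ ⟨h, hh, hGh, rfl⟩
  rintro _ ⟨k, -, hk, rfl⟩
  exact hk t ht

theorem concaveOn_affine (p g c : ℝ) : ConcaveOn ℝ (Ici 0) fun t => p + g * (t - c) := by
  refine ⟨convex_Ici 0, fun x _ y _ u v _ _ huv => le_of_eq ?_⟩
  obtain rfl : v = 1 - u := by linarith
  simp only [smul_eq_mul]
  ring

/-- If `G` is close to `F` in the sense that increments over an interval of length `d` differ by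
at most `A h d + B h²`, and `F` lies below a parabola touching it at `c`, then the least concave
majorant of `G` exceeds `G` at `c` by at most a multiple of `h²`. -/
theorem abs_leastConcaveMajorant_sub_le {F G : ℝ → ℝ} {a b g A B h c : ℝ} (hb : 0 < b)
    (hg : 0 ≤ g) (hc : c ∈ Icc 0 a) (hG : ∀ t, a ≤ t → G t = G a)
    (hF : ∀ t ∈ Icc 0 a, F t ≤ F c + g * (t - c) - b / 2 * (t - c) ^ 2)
    (hFG : ∀ s ∈ Icc 0 a, ∀ t ∈ Icc 0 a, s ≤ t →
      |(G t - G s) - (F t - F s)| ≤ A * h * (t - s) + B * h ^ 2) :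
    |leastConcaveMajorant G c - G c| ≤ (A ^ 2 / (2 * b) + B) * h ^ 2 := by
  have hmain : ∀ t ∈ Icc 0 a, G t ≤ G c + (A ^ 2 / (2 * b) + B) * h ^ 2 + g * (t - c) := by
    intro t ht
    have habs : G t - G c - (F t - F c) ≤ A * h * |t - c| + B * h ^ 2 := by
      rcases le_total c t with h1 | h1
      · rw [abs_of_nonneg (sub_nonneg.2 h1)]
        exact (le_abs_self _).trans (hFG c hc t ht h1)
      · rw [abs_of_nonpos (sub_nonpos.2 h1)]
        have h2 := (abs_le.1 (hFG t ht c hc h1)).1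
        linarith
    -- Completing the square: the maximum over `|t - c|` is attained at `A h / b`.
    have hsq : A * h * |t - c| - b / 2 * (t - c) ^ 2 ≤ A ^ 2 / (2 * b) * h ^ 2 := by
      rw [← sq_abs (t - c)]
      have h3 : A ^ 2 / (2 * b) * h ^ 2 - (A * h * |t - c| - b / 2 * |t - c| ^ 2) =
          (A * h - b * |t - c|) ^ 2 / (2 * b) := by
        field_simp
        ring
      have h4 : 0 ≤ (A * h - b * |t - c|) ^ 2 / (2 * b) := by positivity
      linarith
    have h5 := hF t ht
    linarith
  have hmaj : ∀ t ∈ Ici (0 : ℝ), G t ≤ G c + (A ^ 2 / (2 * b) + B) * h ^ 2 + g * (t - c) := by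
    intro t ht
    rcases le_total t a with h1 | h1
    · exact hmain t ⟨ht, h1⟩
    -- Beyond `a` the function `G` is constant, while the line does not decrease because `g ≥ 0`.
    · rw [hG t h1]
      have h2 := hmain a ⟨hc.1.trans hc.2, le_rfl⟩
      have h3 := mul_le_mul_of_nonneg_left h1 hg
      linarith
  have hconc := concaveOn_affine (G c + (A ^ 2 / (2 * b) + B) * h ^ 2) g c
  have hle := leastConcaveMajorant_le hconc hmaj hc.1
  have hge := le_leastConcaveMajorant hconc hmaj hc.1
  rw [abs_of_nonneg (sub_nonneg.2 hge)]
  linarith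

/-- Passing from the points of a grid of mesh `δ` to arbitrary points. -/
theorem abs_increment_sub_le_of_grid {F G : ℝ → ℝ} {D δ h K : ℝ} {m : ℕ} (hD : 0 ≤ D)
    (hδ : 0 < δ) (hh0 : 0 ≤ h) (hh1 : h ≤ 1) (hK : 0 ≤ K) (hG : Monotone G) (hF : Monotone F)
    (hFD : ∀ s t, 0 ≤ s → s ≤ t → F t - F s ≤ D * (t - s))
    (hgrid : ∀ i j : ℕ, i ≤ j → j ≤ m + 1 →
      |(G (j * δ) - G (i * δ)) - (F (j * δ) - F (i * δ))| ≤
        h * (F (j * δ) - F (i * δ)) + K * h ^ 2)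
    {s t : ℝ} (hs : 0 ≤ s) (hst : s ≤ t) (ht : t ≤ m * δ) :
    |(G t - G s) - (F t - F s)| ≤ D * h * (t - s) + (4 * (D * δ) + K * h ^ 2) := by
  obtain ⟨i, hi1, hi2⟩ : ∃ i : ℕ, i * δ ≤ s ∧ s < (i + 1 : ℕ) * δ := by
    refine ⟨⌊s / δ⌋₊, (le_div_iff₀ hδ).1 (Nat.floor_le (by positivity)), ?_⟩
    rw [← div_lt_iff₀ hδ]
    push_cast
    exact Nat.lt_floor_add_one _
  obtain ⟨j, hj1, hj2⟩ : ∃ j : ℕ, j * δ ≤ t ∧ t < (j + 1 : ℕ) * δ := by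
    have ht0 := hs.trans hst
    refine ⟨⌊t / δ⌋₊, (le_div_iff₀ hδ).1 (Nat.floor_le (by positivity)), ?_⟩
    rw [← div_lt_iff₀ hδ]
    push_cast
    exact Nat.lt_floor_add_one _
  have hjm : j ≤ m := by
    have : (j : ℝ) ≤ m := le_of_mul_le_mul_right (hj1.trans ht) hδ
    exact_mod_cast this
  have hij : i ≤ j := by
    have h1 : (i : ℝ) * δ < (j + 1 : ℕ) * δ := (hi1.trans hst).trans_lt hj2
    have h2 : (i : ℝ) < (j + 1 : ℕ) := lt_of_mul_lt_mul_right h1 hδ.le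
    have h3 : i < j + 1 := by exact_mod_cast h2
    omega
  have hi0 : (0 : ℝ) ≤ i * δ := by positivity
  have hj0 : (0 : ℝ) ≤ j * δ := by positivity
  have ei : ((i + 1 : ℕ) : ℝ) * δ = i * δ + δ := by push_cast; ring
  have ej : ((j + 1 : ℕ) : ℝ) * δ = j * δ + δ := by push_cast; ring
  have hDδ : 0 ≤ D * δ := by positivity
  have hDs (x y : ℝ) (hx : 0 ≤ x) (hxy : x ≤ y) (hy : y ≤ x + δ) : F y - F x ≤ D * δ :=
    (hFD x y hx hxy).trans (mul_le_mul_of_nonneg_left (by linarith) hD)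
  have hKh : 0 ≤ K * h ^ 2 := by positivity
  have hhd : D * h * (t - s) = h * (D * (t - s)) := by ring
  have hFst := hFD s t hs hst
  have hhFst := mul_le_mul_of_nonneg_left hFst hh0
  have hhDδ : h * (D * δ) ≤ D * δ := mul_le_of_le_one_left hDδ hh1
  rw [abs_le]
  constructor
  -- Lower bound: shrink `[s, t]` to the grid points inside it. If both ends share a cell, there are
  -- none, and monotonicity of `G` suffices.
  · rcases hij.eq_or_lt with rfl | hlt
    · have h1 := hDs s t hs hst (by linarith)
      have h2 := hG hst
      have h3 : 0 ≤ D * h * (t - s) := mul_nonneg (mul_nonneg hD hh0) (by linarith)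
      linarith
    · have hg := (abs_le.1 (hgrid (i + 1) j hlt (by omega))).1
      have h1 := hG hj1
      have h2 := hG hi2.le
      have h3 := hDs (j * δ) t hj0 hj1 (by linarith)
      have h4 := hDs s ((i + 1 : ℕ) * δ) hs hi2.le (by linarith)
      have h5 : F (j * δ) - F ((i + 1 : ℕ) * δ) ≤ F t - F s :=
        sub_le_sub (hF hj1) (hF hi2.le)
      have h6 := mul_le_mul_of_nonneg_left h5 hh0
      linarith
  -- Upper bound: enlarge to the surrounding grid points; `j + 1` may equal `m + 1`, hence the extra
  -- grid point.
  · have hg := (abs_le.1 (hgrid i (j + 1) (by omega) (by omega))).2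
    have h1 := hG hi1
    have h2 := hG hj2.le
    have h3 := hDs (i * δ) s hi0 hi1 (by linarith)
    have h4 := hDs t ((j + 1 : ℕ) * δ) (hs.trans hst) hj2.le (by linarith)
    have h5 : F ((j + 1 : ℕ) * δ) - F (i * δ) ≤ D * (t - s) + 2 * (D * δ) := by linarith
    have h6 := mul_le_mul_of_nonneg_left h5 hh0
    linarith

/-! ### Chernoff bounds -/

section Chernoff

variable {Ω : Type*} [MeasurableSpace Ω] {P : Measure Ω} [IsProbabilityMeasure P]
  {μ : Measure ℝ} {X : ℕ → Ω → ℝ}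

/-- The Bernoulli value `1 + p (e^l - 1)` is at most `exp (p (l + l²))`, since `e^l - 1 ≤ l + l²`
for `|l| ≤ 1`. -/
theorem mgf_indicator_le {Y : Ω → ℝ} (hY : Measurable Y) (hYμ : P.map Y = μ) {I : Set ℝ}
    (hI : MeasurableSet I) {l : ℝ} (hl : |l| ≤ 1) :
    mgf (fun ω => I.indicator (fun _ => (1 : ℝ)) (Y ω)) P l ≤
      Real.exp (μ.real I * (l + l ^ 2)) := by
  have h1 : (fun ω => Real.exp (l * I.indicator (fun _ => (1 : ℝ)) (Y ω))) =
      fun ω => 1 + (Y ⁻¹' I).indicator (fun _ => Real.exp l - 1) ω := by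
    funext ω
    by_cases h : Y ω ∈ I <;> simp [h]
  have hm : MeasurableSet (Y ⁻¹' I) := hY hI
  have h2 : P.real (Y ⁻¹' I) = μ.real I := by
    rw [← hYμ, map_measureReal_apply hY hI]
  have h3 : mgf (fun ω => I.indicator (fun _ => (1 : ℝ)) (Y ω)) P l =
      1 + μ.real I * (Real.exp l - 1) := by
    rw [mgf, h1, integral_add (integrable_const _)
      ((integrable_const _).indicator hm), integral_indicator_const _ hm, h2]
    simp
  rw [h3]
  have h4 := (abs_le.1 (Real.abs_exp_sub_one_sub_id_le hl)).2
  have h5 : μ.real I * (Real.exp l - 1) ≤ μ.real I * (l + l ^ 2) :=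
    mul_le_mul_of_nonneg_left (by linarith) measureReal_nonneg
  linarith [Real.add_one_le_exp (μ.real I * (l + l ^ 2))]

theorem mgf_sum_indicator_le (hX_meas : ∀ i, Measurable (X i)) (hX_indep : iIndepFun X P)
    (hX_law : ∀ i, P.map (X i) = μ) {I : Set ℝ} (hI : MeasurableSet I) {l : ℝ} (hl : |l| ≤ 1)
    (n : ℕ) :
    mgf (fun ω => ∑ i ∈ Finset.range n, I.indicator (fun _ => (1 : ℝ)) (X i ω)) P l ≤
      Real.exp (n * (μ.real I * (l + l ^ 2))) := by
  have hind : Measurable (I.indicator fun _ => (1 : ℝ)) := measurable_const.indicator hI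
  have hindep : iIndepFun (fun i ω => I.indicator (fun _ => (1 : ℝ)) (X i ω)) P :=
    hX_indep.comp (fun _ => I.indicator fun _ => (1 : ℝ)) fun _ => hind
  have h1 := hindep.mgf_sum (t := l) (fun i => hind.comp (hX_meas i)) (Finset.range n)
  have h2 : (∑ i ∈ Finset.range n, fun ω => I.indicator (fun _ => (1 : ℝ)) (X i ω)) =
      fun ω => ∑ i ∈ Finset.range n, I.indicator (fun _ => (1 : ℝ)) (X i ω) := by
    funext ω
    rw [Finset.sum_apply]
  rw [h2] at h1
  rw [h1]
  refine (Finset.prod_le_prod (fun _ _ => mgf_nonneg)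
    fun i _ => mgf_indicator_le (hX_meas i) (hX_law i) hI hl).trans ?_
  rw [Finset.prod_const, Finset.card_range, ← Real.exp_nat_mul]

/-- Chernoff's inequality with parameter `±h`, equal to the relative deviation: all terms in `μ.real
I` cancel in the exponent, so the bound is the same for every `I`. -/
theorem measureReal_abs_sum_indicator_sub_gt_le (hX_meas : ∀ i, Measurable (X i))
    (hX_indep : iIndepFun X P) (hX_law : ∀ i, P.map (X i) = μ) {I : Set ℝ}
    (hI : MeasurableSet I) {h : ℝ} (hh0 : 0 ≤ h) (hh1 : h ≤ 1) (K : ℝ) (n : ℕ) :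
    P.real {ω | n * (h * μ.real I + K * h ^ 2) <
        |(∑ i ∈ Finset.range n, I.indicator (fun _ => (1 : ℝ)) (X i ω)) - n * μ.real I|} ≤
      2 * Real.exp (-K * (n * h ^ 3)) := by
  set S : Ω → ℝ := fun ω => ∑ i ∈ Finset.range n, I.indicator (fun _ => (1 : ℝ)) (X i ω)
    with hS
  set p := μ.real I
  have hS_meas : Measurable S := Finset.measurable_sum _ fun i _ =>
    (measurable_const.indicator hI).comp (hX_meas i)
  have hS0 (ω : Ω) : |S ω| ≤ n := by
    have h1 : ∀ i ∈ Finset.range n, |I.indicator (fun _ => (1 : ℝ)) (X i ω)| ≤ 1 := by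
      intro i _
      by_cases h : X i ω ∈ I <;> simp [h]
    refine (Finset.abs_sum_le_sum_abs _ _).trans ((Finset.sum_le_sum h1).trans ?_)
    simp
  have hint (l : ℝ) : Integrable (fun ω => Real.exp (l * S ω)) P := by
    refine Integrable.of_bound (by fun_prop) (Real.exp (|l| * n)) (ae_of_all _ fun ω => ?_)
    rw [Real.norm_eq_abs, Real.abs_exp, Real.exp_le_exp]
    refine (le_abs_self _).trans ?_
    rw [abs_mul]
    exact mul_le_mul_of_nonneg_left (hS0 ω) (abs_nonneg _)
  have habs : |h| ≤ 1 := by rwa [abs_of_nonneg hh0]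
  have hup : P.real {ω | n * (p + h * p + K * h ^ 2) ≤ S ω} ≤ Real.exp (-K * (n * h ^ 3)) := by
    refine (measure_ge_le_exp_mul_mgf _ hh0 (hint h)).trans ?_
    refine (mul_le_mul_of_nonneg_left
      (mgf_sum_indicator_le hX_meas hX_indep hX_law hI habs n) (Real.exp_nonneg _)).trans ?_
    rw [← Real.exp_add, Real.exp_le_exp]
    refine le_of_eq ?_
    ring
  have hlow : P.real {ω | S ω ≤ n * (p - h * p - K * h ^ 2)} ≤
      Real.exp (-K * (n * h ^ 3)) := by
    refine (measure_le_le_exp_mul_mgf _ (neg_nonpos.2 hh0) (hint (-h))).trans ?_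
    refine (mul_le_mul_of_nonneg_left (mgf_sum_indicator_le hX_meas hX_indep hX_law hI
      (l := -h) (by rwa [abs_neg]) n) (Real.exp_nonneg _)).trans ?_
    rw [← Real.exp_add, Real.exp_le_exp]
    refine le_of_eq ?_
    ring
  have hsub : {ω | n * (h * p + K * h ^ 2) < |S ω - n * p|} ⊆
      {ω | n * (p + h * p + K * h ^ 2) ≤ S ω} ∪ {ω | S ω ≤ n * (p - h * p - K * h ^ 2)} := by
    intro ω hω
    rcases lt_abs.1 (show n * (h * p + K * h ^ 2) < |S ω - n * p| from hω) with h1 | h1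
    · left
      show n * (p + h * p + K * h ^ 2) ≤ S ω
      linarith
    · right
      show S ω ≤ n * (p - h * p - K * h ^ 2)
      linarith
  have h1 := (measureReal_mono (μ := P) hsub).trans (measureReal_union_le _ _)
  linarith

end Chernoff

/-! ### The empirical process on a grid -/

/-- The cube root of `log n / n`. -/
noncomputable def rate (n : ℕ) : ℝ := ((n : ℝ)⁻¹ * Real.log n) ^ (1 / 3 : ℝ)

theorem inv_mul_log_nonneg (n : ℕ) : 0 ≤ (n : ℝ)⁻¹ * Real.log n :=
  mul_nonneg (by positivity) (Real.log_natCast_nonneg n)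

theorem rate_nonneg (n : ℕ) : 0 ≤ rate n := Real.rpow_nonneg (inv_mul_log_nonneg n) _

theorem rate_le_one (n : ℕ) : rate n ≤ 1 := by
  refine Real.rpow_le_one (inv_mul_log_nonneg n) ?_ (by norm_num)
  rw [inv_mul_eq_div]
  exact div_le_one_of_le₀ (Real.log_le_self (Nat.cast_nonneg n)) (Nat.cast_nonneg n)

theorem rate_sq (n : ℕ) : rate n ^ 2 = ((n : ℝ)⁻¹ * Real.log n) ^ (2 / 3 : ℝ) := by
  rw [rate, ← Real.rpow_natCast, ← Real.rpow_mul (inv_mul_log_nonneg n)]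
  norm_num

theorem natCast_mul_rate_cube {n : ℕ} (hn : n ≠ 0) : n * rate n ^ 3 = Real.log n := by
  rw [rate, ← Real.rpow_natCast, ← Real.rpow_mul (inv_mul_log_nonneg n)]
  norm_num
  field_simp

/-- Lets the discretization error, of order `1 / n`, be absorbed into `h²`; `3 ≤ n` ensures `log n ≥
1`. -/
theorem inv_le_rate_sq {n : ℕ} (hn : 3 ≤ n) : (n : ℝ)⁻¹ ≤ rate n ^ 2 := by
  have hn3 : (3 : ℝ) ≤ n := by exact_mod_cast hn
  have hlog : 1 ≤ Real.log n := by
    rw [Real.le_log_iff_exp_le (by linarith)]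
    exact Real.exp_one_lt_three.le.trans hn3
  rw [rate_sq]
  calc (n : ℝ)⁻¹ = (n : ℝ)⁻¹ ^ (1 : ℝ) := (Real.rpow_one _).symm
    _ ≤ (n : ℝ)⁻¹ ^ (2 / 3 : ℝ) :=
        Real.rpow_le_rpow_of_exponent_ge (by positivity) (inv_le_one_of_one_le₀ (by linarith))
          (by norm_num)
    _ ≤ _ := by
        refine Real.rpow_le_rpow (by positivity) ?_ (by norm_num)
        exact le_mul_of_one_le_right (by positivity) hlog

theorem ae_forall_le_of_cdf_eq_one {Ω : Type*} [MeasurableSpace Ω] {P : Measure Ω}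
    {μ : Measure ℝ} [IsProbabilityMeasure μ] {X : ℕ → Ω → ℝ} (hX_meas : ∀ i, Measurable (X i))
    (hX_law : ∀ i, P.map (X i) = μ) {a : ℝ} (ha : cdf μ a = 1) :
    ∀ᵐ ω ∂P, ∀ i, X i ω ≤ a := by
  refine ae_all_iff.2 fun i => ?_
  have h1 : ∀ᵐ x ∂μ, x ∈ Iic a := by
    refine (mem_ae_iff_prob_eq_one measurableSet_Iic).2 ?_
    rw [← ofReal_cdf, ha, ENNReal.ofReal_one]
  rw [← hX_law i] at h1
  exact ae_of_ae_map (hX_meas i).aemeasurable h1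

section Grid

variable {Ω : Type*} [MeasurableSpace Ω] {P : Measure Ω} [IsProbabilityMeasure P]
  {μ : Measure ℝ} {X : ℕ → Ω → ℝ}

/-- Because `n h³ = log n`, the factor `4` makes each exceptional probability at most `2 n⁻⁴`. The
union over `(n + 2)² ≤ 9 n²` pairs is then summable, and Borel–Cantelli applies. -/
theorem ae_eventually_grid (hX_meas : ∀ i, Measurable (X i)) (hX_indep : iIndepFun X P)
    (hX_law : ∀ i, P.map (X i) = μ) (t : ℕ → ℕ → ℝ) :
    ∀ᵐ ω ∂P, ∀ᶠ n : ℕ in atTop, ∀ i < n + 2, ∀ j < n + 2,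
      |(∑ k ∈ Finset.range n, (Ioc (t n i) (t n j)).indicator (fun _ => (1 : ℝ)) (X k ω)) -
        n * μ.real (Ioc (t n i) (t n j))| ≤
      n * (rate n * μ.real (Ioc (t n i) (t n j)) + 4 * rate n ^ 2) := by
  let B (n i j : ℕ) : Set Ω :=
    {ω | n * (rate n * μ.real (Ioc (t n i) (t n j)) + 4 * rate n ^ 2) <
      |(∑ k ∈ Finset.range n, (Ioc (t n i) (t n j)).indicator (fun _ => (1 : ℝ)) (X k ω)) -
        n * μ.real (Ioc (t n i) (t n j))|}
  let E (n : ℕ) : Set Ω := ⋃ q ∈ Finset.range (n + 2) ×ˢ Finset.range (n + 2), B n q.1 q.2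
  have hE : ∀ n : ℕ, 1 ≤ n → P.real (E n) ≤ 18 * (1 / (n : ℝ) ^ 2) := by
    intro n hn
    have hn1 : (1 : ℝ) ≤ n := by exact_mod_cast hn
    have hB : ∀ q ∈ Finset.range (n + 2) ×ˢ Finset.range (n + 2),
        P.real (B n q.1 q.2) ≤ 2 * ((n : ℝ) ^ 4)⁻¹ := by
      intro q _
      have h1 := measureReal_abs_sum_indicator_sub_gt_le hX_meas hX_indep hX_law
        (measurableSet_Ioc (a := t n q.1) (b := t n q.2)) (rate_nonneg n) (rate_le_one n) 4 n
      rw [natCast_mul_rate_cube (by omega)] at h1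
      have h2 : Real.exp (-4 * Real.log n) = ((n : ℝ) ^ 4)⁻¹ := by
        rw [neg_mul, Real.exp_neg, show (4 : ℝ) * Real.log n = ((4 : ℕ) : ℝ) * Real.log n by
          norm_num, Real.exp_nat_mul, Real.exp_log (by linarith)]
      rw [h2] at h1
      exact h1
    refine (measureReal_biUnion_finset_le _ _).trans ((Finset.sum_le_sum hB).trans ?_)
    rw [Finset.sum_const, Finset.card_product, Finset.card_range, nsmul_eq_mul]
    push_cast
    have h3 : ((n : ℝ) + 2) * (n + 2) ≤ 9 * n ^ 2 := by nlinarith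
    calc ((n : ℝ) + 2) * (n + 2) * (2 * ((n : ℝ) ^ 4)⁻¹)
        ≤ 9 * n ^ 2 * (2 * ((n : ℝ) ^ 4)⁻¹) := by gcongr
      _ = 18 * (1 / (n : ℝ) ^ 2) := by field_simp; norm_num
  have hsum : Summable fun n => P.real (E n) := by
    refine Summable.of_norm_bounded_eventually_nat
      ((Real.summable_one_div_nat_pow.2 one_lt_two).mul_left 18) ?_
    filter_upwards [eventually_ge_atTop 1] with n hn
    rw [Real.norm_of_nonneg measureReal_nonneg]
    exact hE n hn
  have htop : ∑' n, P (E n) ≠ ⊤ := by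
    have h1 := hsum.tsum_ofReal_ne_top
    simpa only [ofReal_measureReal (measure_ne_top P _)] using h1
  filter_upwards [ae_eventually_notMem htop] with ω hω
  filter_upwards [hω] with n hn i hi j hj
  by_contra hlt
  refine hn (mem_biUnion (x := (i, j)) ?_ (not_le.1 hlt))
  simp [hi, hj]

/-- Almost surely, for large `n`, the increments of the empirical distribution function over
intervals of length `d` differ from those of the distribution function by at most a multiple of
`h d + h²`, where `h³ = log n / n`. -/
theorem ae_eventually_abs_increment_sub_le [IsProbabilityMeasure μ]
    (hX_meas : ∀ i, Measurable (X i)) (hX_indep : iIndepFun X P)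
    (hX_law : ∀ i, P.map (X i) = μ) {a D : ℝ} (ha : 0 < a) (hD : 0 ≤ D)
    (hFD : ∀ s t, 0 ≤ s → s ≤ t → cdf μ t - cdf μ s ≤ D * (t - s)) :
    ∀ᵐ ω ∂P, ∀ᶠ n : ℕ in atTop, ∀ s ∈ Icc 0 a, ∀ t ∈ Icc 0 a, s ≤ t →
      |(empiricalCDF (fun i => X i ω) n t - empiricalCDF (fun i => X i ω) n s) -
        (cdf μ t - cdf μ s)| ≤ D * rate n * (t - s) + (4 * D * a + 4) * rate n ^ 2 := by
  filter_upwards [ae_eventually_grid hX_meas hX_indep hX_law fun n i => i * (a / n)] with ω hω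
  filter_upwards [hω, eventually_ge_atTop 3] with n hn hn3 s hs t ht hst
  have hn0 : (0 : ℝ) < n := by exact_mod_cast (by omega : 0 < n)
  have hδ : 0 < a / n := by positivity
  have hgrid : ∀ i j : ℕ, i ≤ j → j ≤ n + 1 →
      |(empiricalCDF (fun i => X i ω) n (j * (a / n)) -
          empiricalCDF (fun i => X i ω) n (i * (a / n))) -
        (cdf μ (j * (a / n)) - cdf μ (i * (a / n)))| ≤
        rate n * (cdf μ (j * (a / n)) - cdf μ (i * (a / n))) + 4 * rate n ^ 2 := by
    intro i j hij hj
    have hle : (i : ℝ) * (a / n) ≤ j * (a / n) := by gcongr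
    have hp : μ.real (Ioc (i * (a / n)) (j * (a / n))) =
        cdf μ (j * (a / n)) - cdf μ (i * (a / n)) := by
      rw [measureReal_def]
      conv_lhs => rw [← measure_cdf μ]
      rw [StieltjesFunction.measure_Ioc,
        ENNReal.toReal_ofReal (sub_nonneg.2 (monotone_cdf μ hle))]
    have h1 := hn i (by omega) j (by omega)
    rw [hp] at h1
    rw [empiricalCDF_sub _ _ hle]
    refine le_of_mul_le_mul_left ?_ hn0
    rw [← abs_of_pos hn0, ← abs_mul, abs_of_pos hn0, mul_sub, mul_inv_cancel_left₀ hn0.ne']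
    exact h1
  have h2 := abs_increment_sub_le_of_grid hD hδ (rate_nonneg n) (rate_le_one n) (by norm_num)
    (empiricalCDF_mono (fun i => X i ω) n) (monotone_cdf μ) hFD hgrid hs.1 hst
    (by rw [mul_div_cancel₀ _ hn0.ne']; exact ht.2)
  have h3 : D * (a / n) ≤ D * a * rate n ^ 2 := by
    rw [div_eq_mul_inv, ← mul_assoc]
    exact mul_le_mul_of_nonneg_left (inv_le_rate_sq hn3) (by positivity)
  linarith

end Grid

end KieferWolfowitz

theorem theorem1p1
    {Ω : Type*} [MeasurableSpace Ω] (P : Measure Ω) [IsProbabilityMeasure P]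
    -- the law `μ` of the observations, with nonincreasing density `f` on `(0, ∞)`
    (μ : Measure ℝ) [IsProbabilityMeasure μ] (f f' : ℝ → ℝ)
    (hf_nonneg : ∀ t ∈ Set.Ioi (0 : ℝ), 0 ≤ f t)
    (hf_anti : AntitoneOn f (Set.Ioi 0))
    (hμ : μ = (volume.restrict (Set.Ioi (0 : ℝ))).withDensity (fun t => ENNReal.ofReal (f t)))
    -- `α₁(F) < ∞`
    (hα : {t : ℝ | cdf μ t = 1}.Nonempty)
    -- `f'` is the derivative of `f` on `(0, α₁(F))` and is continuous up to the endpoints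
    (hf' : ∀ t ∈ Set.Ioo 0 (KieferWolfowitz.alphaOne (cdf μ)), HasDerivAt f (f' t) t)
    (hf'_cont : ContinuousOn f' (Set.Icc 0 (KieferWolfowitz.alphaOne (cdf μ))))
    (hβ : 0 < KieferWolfowitz.betaOne f f' (KieferWolfowitz.alphaOne (cdf μ)))
    (hγ : KieferWolfowitz.gammaOne f f' (KieferWolfowitz.alphaOne (cdf μ)) < ⊤)
    -- an i.i.d. sample from `μ`
    (X : ℕ → Ω → ℝ) (hX_meas : ∀ i, Measurable (X i))
    (hX_indep : iIndepFun X P) (hX_law : ∀ i, P.map (X i) = μ) :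
    ∃ C : ℝ, ∀ᵐ ω ∂P, Asymptotics.IsBigOWith C atTop
      (fun n : ℕ => KieferWolfowitz.supNorm (KieferWolfowitz.alphaOne (cdf μ))
        (fun t => KieferWolfowitz.grenanderCDF (fun i => X i ω) n t -
          KieferWolfowitz.empiricalCDF (fun i => X i ω) n t))
      (fun n : ℕ => ((n : ℝ)⁻¹ * Real.log n) ^ (2 / 3 : ℝ)) := by
  have ha := KieferWolfowitz.alphaOne_pos hμ hα
  have hFa := KieferWolfowitz.cdf_alphaOne hα
  set a := KieferWolfowitz.alphaOne (cdf μ)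
  obtain ⟨b, hb, hbf⟩ := KieferWolfowitz.exists_pos_le_neg_deriv ha hβ hγ
  obtain ⟨D, hD, hfD⟩ := KieferWolfowitz.exists_density_bound ha hf_anti hf' hf'_cont
  have hanti := KieferWolfowitz.antitoneOn_add_mul hf' hbf
  refine ⟨D ^ 2 / (2 * b) + (4 * D * a + 4), ?_⟩
  filter_upwards [KieferWolfowitz.ae_forall_le_of_cdf_eq_one hX_meas hX_law hFa,
    KieferWolfowitz.ae_eventually_abs_increment_sub_le hX_meas hX_indep hX_law ha hD
      fun s t hs hst => KieferWolfowitz.cdf_sub_cdf_le_mul hf_nonneg hf_anti hμ hfD hs hst]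
    with ω hle hincr
  rw [Asymptotics.isBigOWith_iff]
  filter_upwards [hincr] with n hn
  rw [← KieferWolfowitz.rate_sq, Real.norm_of_nonneg (sq_nonneg _), KieferWolfowitz.supNorm,
    Real.norm_of_nonneg (Real.iSup_nonneg fun _ => abs_nonneg _)]
  refine Real.iSup_le (fun c => ?_) (by positivity)
  -- Only the slope `g` depends on `c`, and it does not enter the final constant.
  obtain ⟨g, hg, hpar⟩ := KieferWolfowitz.exists_supporting_parabola ha hb.le hD hf_nonneg
    hf_anti hμ hfD hanti c.2
  exact KieferWolfowitz.abs_leastConcaveMajorant_sub_le hb hg c.2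
    (fun t ht => KieferWolfowitz.empiricalCDF_eq_of_forall_le hle n ht) hpar hn
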